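/- Let $(X,\omega)$ be a compact Kähler manifold. A function $u:X\to[-\infty,+\infty)$ is called $\omega$-psh, $u\in\mathrm{PSH}(X,\omega)$, if it is upper semicontinuous, not identically $-\infty$ on any connected component of $X$, and satisfies $\omega+dd^c u\ge 0$, i.e. $\varphi+u$ is plurisubharmonic wherever $\varphi$ is a smooth local potential of $\omega$ ($dd^c\varphi=\omega$). For $h:X\to(-\infty,+\infty]$ the $\omega$-psh envelope of $h$ is $$P_\omega(h)(x)=\sup\{v(x):\ v\in\mathrm{PSH}(X,\omega),\ v\le h \text{ on } X\},\qquad x\in X .$$ A pair $(\mu,b)$, where $\mu$ is a finite positive Borel measure on $X$ and $b\in\mathbb R$, is a Jensen pair with barycenter at $x\in X$ if $$u(x)\le\int_X u\,d\mu+b\qquad\text{for all } u\in\mathrm{PSH}(X,\omega).$$ Let $\mathcal{JP}_{\omega,x}$ be the set of these pairs and put $$E_\omega(h)(x)=\inf\Big\{\int_X h\,d\mu+b:\ (\mu,b)\in\mathcal{JP}_{\omega,x}\Big\}.$$ **Theorem.** If $h:X\to(-\infty,+\infty]$ is lower semicontinuous, then $P_\omega(h)(x)=E_\omega(h)(x)$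 for every $x\in X$ (as elements of $(-\infty,+\infty]$). If moreover $h$ is continuous and real-valued, then the upper semicontinuous regularization $P_\omega(h)^*$ of $P_\omega(h)$ also equals $E_\omega(h)$ everywhere on $X$. -/

import Mathlib

open MeasureTheory Filter Topology Set
open scoped Manifold ContDiff ENNReal

/-- The model space `ℂⁿ`. -/
abbrev Cn (n : ℕ) : Type := EuclideanSpace ℂ (Fin n)

noncomputable section

/-- The integral of an extended-real function, `∫ f⁺ dμ - ∫ f⁻ dμ` in `[-∞, +∞]`. It is only used
where at least one of the two terms is finite. -/
def eintegral {α : Type*} [MeasurableSpace α] (μ : Measure α) (f : α → EReal) : EReal :=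
  ((∫⁻ a, (f a).toENNReal ∂μ : ℝ≥0∞) : EReal) - ((∫⁻ a, (-f a).toENNReal ∂μ : ℝ≥0∞) : EReal)

/-- The mean of `f` over the circle `θ ↦ a + e^{iθ} b`, `0 ≤ θ ≤ 2π`, with respect to the
normalized Lebesgue measure. -/
def circleMean {n : ℕ} (f : Cn n → EReal) (a b : Cn n) : EReal :=
  eintegral (ENNReal.ofReal (2 * Real.pi)⁻¹ • (volume : Measure ℝ).restrict (Icc 0 (2 * Real.pi)))
    (fun θ : ℝ => f (a + Complex.exp (θ * Complex.I) • b))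

/-- Plurisubharmonicity on an open set `D ⊆ ℂⁿ` of a function with values in `[-∞, +∞)`: upper
semicontinuity and the sub-mean value inequality on every closed complex disc inside `D`.
(Being identically `-∞` is not excluded here.) -/
structure IsPshOn {n : ℕ} (f : Cn n → EReal) (D : Set (Cn n)) : Prop where
  lt_top : ∀ z ∈ D, f z < ⊤
  usc : UpperSemicontinuousOn f D
  submean : ∀ a b : Cn n, (∀ ζ : ℂ, ‖ζ‖ ≤ 1 → a + ζ • b ∈ D) → f a ≤ circleMean f a b

/-- The value at `(v, w)` of the real `(1,1)`-form `dd^c φ`, where `d^c φ = - dφ ∘ J` and `J` is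
multiplication by `i`; that is, `dd^c = 2 i ∂ ∂̄`. -/
def ddc {n : ℕ} (φ : Cn n → ℝ) (z v w : Cn n) : ℝ :=
  fderiv ℝ (fderiv ℝ φ) z w (Complex.I • v) - fderiv ℝ (fderiv ℝ φ) z v (Complex.I • w)

section Manifold

variable (n : ℕ) (X : Type*) [TopologicalSpace X] [ChartedSpace (Cn n) X]

variable {n X} in
/-- The expression in a chart `e` of a real 2-form `α` on `X`: its pullback by `e⁻¹`. -/
def formInChart (α : ∀ x : X, TangentSpace 𝓘(ℝ, Cn n) x [⋀^Fin 2]→L[ℝ] ℝ)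
    (e : OpenPartialHomeomorph X (Cn n)) (z : Cn n) : Cn n [⋀^Fin 2]→L[ℝ] ℝ :=
  (α (e.symm z)).compContinuousLinearMap (mfderiv 𝓘(ℝ, Cn n) 𝓘(ℝ, Cn n) e.symm z)

/-- A Kähler form on a complex manifold `X`: a smooth, closed, positive real `(1,1)`-form. -/
structure KahlerForm where
  /-- the underlying real 2-form -/
  form : ∀ x : X, TangentSpace 𝓘(ℝ, Cn n) x [⋀^Fin 2]→L[ℝ] ℝ
  smooth : ∀ e ∈ atlas (Cn n) X, ContDiffOn ℝ ∞ (formInChart form e) e.target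
  closed : ∀ e ∈ atlas (Cn n) X, ∀ z ∈ e.target, extDeriv (formInChart form e) z = 0
  type_one_one : ∀ e ∈ atlas (Cn n) X, ∀ z ∈ e.target, ∀ v w : Cn n,
    formInChart form e z ![Complex.I • v, Complex.I • w] = formInChart form e z ![v, w]
  pos : ∀ e ∈ atlas (Cn n) X, ∀ z ∈ e.target, ∀ v : Cn n, v ≠ 0 →
    0 < formInChart form e z ![v, Complex.I • v]

end Manifold

section Envelopes

variable {n : ℕ} {X : Type*} [TopologicalSpace X] [ChartedSpace (Cn n) X]

/-- `φ` is a smooth local potential of the Kähler form on the open set `D` of the target of the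
chart `e`: `dd^c φ` is the Kähler form there. (Local potentials exist near every point, since the
form is closed.) -/
structure IsLocalPotential (K : KahlerForm n X) (e : OpenPartialHomeomorph X (Cn n))
    (D : Set (Cn n)) (φ : Cn n → ℝ) : Prop where
  isOpen : IsOpen D
  subset : D ⊆ e.target
  smooth : ContDiffOn ℝ ∞ φ D
  ddc_eq : ∀ z ∈ D, ∀ v w : Cn n, ddc φ z v w = formInChart K.form e z ![v, w]

/-- The `ω`-psh functions: upper semicontinuous `u : X → [-∞, +∞)`, not identically `-∞` on any
connected component, with `ω + dd^c u ≥ 0`, that is, `φ + u` is plurisubharmonic for every local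
potential `φ` of `ω`. -/
structure IsOmegaPsh (K : KahlerForm n X) (u : X → EReal) : Prop where
  lt_top : ∀ x, u x < ⊤
  usc : UpperSemicontinuous u
  nontrivial : ∀ x, ∃ y ∈ connectedComponent x, u y ≠ ⊥
  psh : ∀ e ∈ atlas (Cn n) X, ∀ (D : Set (Cn n)) (φ : Cn n → ℝ), IsLocalPotential K e D φ →
    IsPshOn (fun z => (φ z : EReal) + u (e.symm z)) D

/-- The `ω`-psh envelope `P_ω(h)(x) = sup {v(x) : v ω-psh, v ≤ h on X}`. -/
def omegaPshEnvelope (K : KahlerForm n X) (h : X → EReal) (x : X) : EReal :=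
  sSup {t : EReal | ∃ v : X → EReal, IsOmegaPsh K v ∧ (∀ y, v y ≤ h y) ∧ t = v x}

/-- The upper semicontinuous regularization `f^*(x) = limsup_{y → x} f(y)` (`y = x` included). -/
def uscReg (f : X → EReal) (x : X) : EReal := limsup f (𝓝 x)

variable [MeasurableSpace X]

/-- `(μ, b)` is a Jensen pair with barycenter `x`. -/
structure IsJensenPair (K : KahlerForm n X) (x : X) (μ : Measure X) (b : ℝ) : Prop where
  finite : IsFiniteMeasure μ
  le : ∀ u : X → EReal, IsOmegaPsh K u → u x ≤ eintegral μ u + (b : EReal)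

/-- `E_ω(h)(x) = inf {∫ h dμ + b : (μ, b) a Jensen pair with barycenter x}`. -/
def jensenEnvelope (K : KahlerForm n X) (h : X → EReal) (x : X) : EReal :=
  sInf {t : EReal | ∃ (μ : Measure X) (b : ℝ), IsJensenPair K x μ b ∧
    t = eintegral μ h + (b : EReal)}

end Envelopes

end

/-! One inequality is immediate: integrating `v ≤ h` against a Jensen pair gives `v x ≤ ∫ h dμ + b`.
The converse is convex duality. For fixed `x`, the envelope is a concave function of a continuous
obstacle `g`, because convex combinations of ω-psh functions are ω-psh. Its open hypograph is convex
and misses every pair `(g, s)` with `g ≤ h` and `s = P_ω(h)(x)`. Separating the two by Hahn–Banach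
(`exists_affine_majorant`) gives an affine functional `Λ + b` that dominates the envelope of every
continuous obstacle and is at most `s` at those below `h`.

Since `0` is ω-psh, `Λ` is positive, hence integration against a finite measure `μ` (Riesz).
Approximating an ω-psh function from above by continuous functions shows that `(μ, b)` is a Jensen
pair; approximating `h` from below gives `∫ h dμ + b ≤ s`. Both limits are monotone convergence on a
metrizable space.

The duality uses only bounded real-valued ω-psh functions (`IsBddOmegaPsh`); truncation from below,
`IsOmegaPsh.exists_isBddOmegaPsh_eq_max`, reduces the general case to them. Constants belong to this
class because `ω ≥ 0`, which is the smooth sub-mean value inequality.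

For continuous `h`, the regularized envelope is still at most `h` and still ω-psh, so it competes in
the supremum and equals the envelope. -/

section SmoothSubmean

/-! ### Circle means of smooth subharmonic functions, in logarithmic polar coordinates -/

variable {E : Type*} [NormedAddCommGroup E] [NormedSpace ℂ E]

lemma hasDerivAt_exp_smul_left (b : E) (s θ : ℝ) :
    HasDerivAt (fun s : ℝ => Complex.exp (s + θ * Complex.I) • b)
      (Complex.exp (s + θ * Complex.I) • b) s := by
  have h : HasDerivAt (fun s : ℝ => (s : ℂ) + θ * Complex.I) 1 s :=
    (Complex.ofRealCLM.hasDerivAt (x := s)).add_const _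
  simpa using (h.cexp).smul_const b

lemma hasDerivAt_exp_smul_right (b : E) (s θ : ℝ) :
    HasDerivAt (fun θ : ℝ => Complex.exp (s + θ * Complex.I) • b)
      (Complex.I • Complex.exp (s + θ * Complex.I) • b) θ := by
  have h : HasDerivAt (fun θ : ℝ => (s : ℂ) + θ * Complex.I) (1 * Complex.I) θ :=
    ((Complex.ofRealCLM.hasDerivAt (x := θ)).mul_const Complex.I).const_add _
  simpa [smul_smul, mul_comm] using (h.cexp).smul_const b

lemma continuous_exp_smul (b : E) :
    Continuous fun p : ℝ × ℝ => Complex.exp (p.1 + p.2 * Complex.I) • b := by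
  fun_prop

lemma exp_add_mul_I_smul_mem {D : Set E} {b : E} (hD : ∀ ζ : ℂ, ‖ζ‖ ≤ 1 → ζ • b ∈ D)
    {s : ℝ} (hs : s ≤ 0) (θ : ℝ) : Complex.exp (s + θ * Complex.I) • b ∈ D := by
  apply hD
  rw [Complex.norm_exp]
  simpa using hs

/-- Differentiation under the integral sign over a period, for a family of curves in an open
set. -/
lemma hasDerivAt_circle_integral {D : Set E} (hDo : IsOpen D) {b : E}
    {F F' : E → ℝ} (hF : ContinuousOn F D) (hF' : ContinuousOn F' D)
    (hder : ∀ s θ : ℝ, Complex.exp (s + θ * Complex.I) • b ∈ D →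
      HasDerivAt (fun s : ℝ => F (Complex.exp (s + θ * Complex.I) • b))
        (F' (Complex.exp (s + θ * Complex.I) • b)) s)
    {s : ℝ} (hs : ∀ θ : ℝ, Complex.exp (s + θ * Complex.I) • b ∈ D) :
    HasDerivAt (fun s : ℝ => ∫ θ in (0 : ℝ)..2 * Real.pi, F (Complex.exp (s + θ * Complex.I) • b))
      (∫ θ in (0 : ℝ)..2 * Real.pi, F' (Complex.exp (s + θ * Complex.I) • b)) s := by
  have hW := continuous_exp_smul b
  -- Compactness of `[0, 2π]` keeps all circles with parameter near `s` inside `D`, which yields a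
  -- uniform bound on the derivative.
  obtain ⟨u, v, hu, -, hsu, hIv, huv⟩ := generalized_tube_lemma (isCompact_singleton (x := s))
    (isCompact_Icc (a := (0 : ℝ)) (b := 2 * Real.pi)) (hDo.preimage hW) (by
      rintro ⟨s', θ⟩ ⟨h1, -⟩
      obtain rfl : s' = s := h1
      exact hs θ)
  obtain ⟨ε, hε, hball⟩ := Metric.nhds_basis_closedBall.mem_iff.1
    (hu.mem_nhds (hsu (mem_singleton s)))
  have hsub : ∀ s' ∈ Metric.closedBall s ε, ∀ θ ∈ Icc 0 (2 * Real.pi),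
      Complex.exp (s' + θ * Complex.I) • b ∈ D := fun s' h1 θ h2 =>
    huv (show (s', θ) ∈ u ×ˢ v from ⟨hball h1, hIv h2⟩)
  have hK : IsCompact (Metric.closedBall s ε ×ˢ Icc 0 (2 * Real.pi)) :=
    (isCompact_closedBall s ε).prod isCompact_Icc
  obtain ⟨C, hC⟩ := hK.exists_bound_of_continuousOn (f := fun p : ℝ × ℝ =>
      F' (Complex.exp (p.1 + p.2 * Complex.I) • b))
    (hF'.comp hW.continuousOn (fun p hp => hsub _ hp.1 _ hp.2))
  have hpi : (0 : ℝ) ≤ 2 * Real.pi := by positivity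
  have hint : ∀ G : E → ℝ, ContinuousOn G D → ∀ s' ∈ Metric.closedBall s ε,
      ContinuousOn (fun θ : ℝ => G (Complex.exp (s' + θ * Complex.I) • b))
        (Icc 0 (2 * Real.pi)) := fun G hG s' h1 =>
    hG.comp (by fun_prop) (fun θ hθ => hsub _ h1 _ hθ)
  have hs0 : s ∈ Metric.closedBall s ε := Metric.mem_closedBall_self hε.le
  have hΙ : Set.uIoc 0 (2 * Real.pi) ⊆ Icc 0 (2 * Real.pi) := by
    rw [uIoc_of_le hpi]; exact Ioc_subset_Icc_self
  refine (intervalIntegral.hasDerivAt_integral_of_dominated_loc_of_deriv_le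
    (μ := volume) (bound := fun _ => C) (Metric.closedBall_mem_nhds s hε)
    (F := fun s' θ => F (Complex.exp ((s' : ℝ) + (θ : ℝ) * Complex.I) • b))
    (F' := fun s' θ => F' (Complex.exp ((s' : ℝ) + (θ : ℝ) * Complex.I) • b)) ?_ ?_ ?_ ?_ ?_ ?_).2
  · filter_upwards [Metric.closedBall_mem_nhds s hε] with s' h'
    exact ((hint F hF s' h').mono hΙ).aestronglyMeasurable measurableSet_uIoc
  · exact (hint F hF s hs0).intervalIntegrable_of_Icc hpi
  · exact ((hint F' hF' s hs0).mono hΙ).aestronglyMeasurable measurableSet_uIoc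
  · exact Eventually.of_forall fun θ hθ s' h' => hC (s', θ) ⟨h', hΙ hθ⟩
  · exact intervalIntegrable_const
  · exact Eventually.of_forall fun θ hθ s' h' => hder s' θ (hsub _ h' _ (hΙ hθ))

/-- As `s → -∞` the circle of radius `e^s` shrinks to the origin. -/
lemma tendsto_circle_integral_atBot {D : Set E} (hDo : IsOpen D) {b : E}
    (hD : ∀ ζ : ℂ, ‖ζ‖ ≤ 1 → ζ • b ∈ D) {F : E → ℝ} (hF : ContinuousOn F D) :
    Tendsto (fun s : ℝ => ∫ θ in (0 : ℝ)..2 * Real.pi, F (Complex.exp (s + θ * Complex.I) • b))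
      atBot (𝓝 (2 * Real.pi * F 0)) := by
  have hpi : (0 : ℝ) ≤ 2 * Real.pi := by positivity
  have hconst : 2 * Real.pi * F 0 = ∫ θ in (0 : ℝ)..2 * Real.pi, F 0 := by simp
  rw [hconst]
  obtain ⟨C, hC⟩ := (isCompact_closedBall (0 : ℂ) 1).exists_bound_of_continuousOn
    (f := fun ζ : ℂ => F (ζ • b))
    (hF.comp (by fun_prop) (fun ζ hζ => hD ζ (by simpa using hζ)))
  refine intervalIntegral.tendsto_integral_filter_of_dominated_convergence (fun _ => C) ?_ ?_ ?_ ?_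
  · filter_upwards [eventually_le_atBot 0] with s hs
    refine ContinuousOn.aestronglyMeasurable ?_ measurableSet_uIoc
    exact hF.comp (by fun_prop) (fun θ _ => exp_add_mul_I_smul_mem hD hs θ)
  · filter_upwards [eventually_le_atBot 0] with s hs
    refine Eventually.of_forall fun θ _ => hC _ ?_
    simpa [Complex.norm_exp] using hs
  · exact intervalIntegrable_const
  · refine Eventually.of_forall fun θ _ => ?_
    have h0 : (0 : E) ∈ D := by simpa using hD 0 (by simp)
    refine (hF.continuousAt (hDo.mem_nhds h0)).tendsto.comp ?_
    rw [tendsto_zero_iff_norm_tendsto_zero]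
    have : Tendsto (fun s : ℝ => Real.exp s * ‖b‖) atBot (𝓝 (0 * ‖b‖)) :=
      Real.tendsto_exp_atBot.mul_const _
    simpa [norm_smul, Complex.norm_exp] using this

set_option maxHeartbeats 1000000 in
/-- The sub-mean value inequality of a smooth function with nonnegative Laplacian along complex
lines. -/
lemma two_pi_mul_le_circle_integral_of_laplacian_nonneg {D : Set E} (hDo : IsOpen D) {φ : E → ℝ}
    (hφ : ContDiffOn ℝ ∞ φ D) {b : E} (hD : ∀ ζ : ℂ, ‖ζ‖ ≤ 1 → ζ • b ∈ D)
    (hΔ : ∀ z ∈ D, ∀ w : E, 0 ≤ fderiv ℝ (fderiv ℝ φ) z w w +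
      fderiv ℝ (fderiv ℝ φ) z (Complex.I • w) (Complex.I • w)) :
    2 * Real.pi * φ 0 ≤
      ∫ θ in (0 : ℝ)..2 * Real.pi, φ (Complex.exp (θ * Complex.I) • b) := by
  have hpi : (0 : ℝ) ≤ 2 * Real.pi := by positivity
  have hφ1 : ContDiffOn ℝ ∞ (fderiv ℝ φ) D := hφ.fderiv_of_isOpen hDo (by simp)
  have hφ2 : ContDiffOn ℝ ∞ (fderiv ℝ (fderiv ℝ φ)) D := hφ1.fderiv_of_isOpen hDo (by simp)
  have hd1 : ∀ z ∈ D, HasFDerivAt φ (fderiv ℝ φ z) z := fun z hz =>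
    ((hφ.contDiffAt (hDo.mem_nhds hz)).differentiableAt (by simp)).hasFDerivAt
  have hd2 : ∀ z ∈ D, HasFDerivAt (fderiv ℝ φ) (fderiv ℝ (fderiv ℝ φ) z) z := fun z hz =>
    ((hφ1.contDiffAt (hDo.mem_nhds hz)).differentiableAt (by simp)).hasFDerivAt
  -- With `w = e^{s+iθ} b`, `F1` and `F2` are the first and second `s`-derivatives of `φ(w)`, and
  -- `F3` is the second `θ`-derivative. `F2 + F3` is the Laplacian term of `hΔ`, and `F3` integrates
  -- to `0` by periodicity, so the circle integral is convex in `s`.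
  set F1 : E → ℝ := fun w => fderiv ℝ φ w w with hF1
  set F2 : E → ℝ := fun w => fderiv ℝ (fderiv ℝ φ) w w w + fderiv ℝ φ w w with hF2
  set F3 : E → ℝ := fun w => fderiv ℝ (fderiv ℝ φ) w (Complex.I • w) (Complex.I • w) -
    fderiv ℝ φ w w with hF3
  have cF1 : ContinuousOn F1 D := hφ1.continuousOn.clm_apply continuousOn_id
  have cF2 : ContinuousOn F2 D :=
    ((hφ2.continuousOn.clm_apply continuousOn_id).clm_apply continuousOn_id).add cF1
  have cI : ContinuousOn (fun w : E => Complex.I • w) D := by fun_prop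
  have cF3 : ContinuousOn F3 D :=
    ((hφ2.continuousOn.clm_apply cI).clm_apply cI).sub cF1
  have hA1 := fun s hs => hasDerivAt_circle_integral (b := b) (s := s) hDo hφ.continuousOn cF1
    (fun s θ h => (hd1 _ h).comp_hasDerivAt s (hasDerivAt_exp_smul_left b s θ)) hs
  have hA2 := fun s hs => hasDerivAt_circle_integral (b := b) (s := s) hDo cF1 cF2
    (fun s θ h => ((hd2 _ h).comp_hasDerivAt s (hasDerivAt_exp_smul_left b s θ)).clm_apply
      (hasDerivAt_exp_smul_left b s θ)) hs
  have hcirc : ∀ s ≤ (0 : ℝ), ∀ G : E → ℝ, ContinuousOn G D → IntervalIntegrable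
      (fun θ : ℝ => G (Complex.exp (s + θ * Complex.I) • b)) volume 0 (2 * Real.pi) := by
    intro s hs G hG
    refine ContinuousOn.intervalIntegrable ?_
    exact hG.comp (by fun_prop) (fun θ _ => exp_add_mul_I_smul_mem hD hs θ)
  have hθ : ∀ s ≤ (0 : ℝ),
      ∫ θ in (0 : ℝ)..2 * Real.pi, F3 (Complex.exp (s + θ * Complex.I) • b) = 0 := by
    intro s hs
    rw [intervalIntegral.integral_eq_sub_of_hasDerivAt (f := fun θ : ℝ =>
      fderiv ℝ φ (Complex.exp (s + θ * Complex.I) • b)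
        (Complex.I • Complex.exp (s + θ * Complex.I) • b)) _ (hcirc s hs F3 cF3)]
    · have : Complex.exp (s + (2 * Real.pi : ℝ) * Complex.I) =
          Complex.exp (s + (0 : ℝ) * Complex.I) := by
        rw [Complex.exp_add, Complex.exp_add]
        simp
      simp only [this, sub_self]
    · intro θ _
      have h := exp_add_mul_I_smul_mem hD hs θ
      have h1 := hasDerivAt_exp_smul_right b s θ
      refine (((hd2 _ h).comp_hasDerivAt θ h1).clm_apply
        (h1.const_smul Complex.I)).congr_deriv ?_
      have hII : ∀ w : E, Complex.I • Complex.I • w = -w := fun w => by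
        rw [smul_smul, Complex.I_mul_I, neg_one_smul]
      simp only [hF3, hII, map_neg, sub_eq_add_neg]
      rfl
  have hA2nn : ∀ s ≤ (0 : ℝ),
      0 ≤ ∫ θ in (0 : ℝ)..2 * Real.pi, F2 (Complex.exp (s + θ * Complex.I) • b) := by
    intro s hs
    have hadd := intervalIntegral.integral_add (hcirc s hs F2 cF2) (hcirc s hs F3 cF3)
    rw [hθ s hs, add_zero] at hadd
    rw [← hadd]
    refine intervalIntegral.integral_nonneg hpi fun θ _ => ?_
    have := hΔ _ (exp_add_mul_I_smul_mem hD hs θ) (Complex.exp (s + θ * Complex.I) • b)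
    simp only [hF2, hF3]
    linarith
  have hmono : ∀ G G' : ℝ → ℝ, (∀ s ≤ 0, HasDerivAt G (G' s) s) → (∀ s ≤ 0, 0 ≤ G' s) →
      MonotoneOn G (Iic 0) := by
    intro G G' hG hG'
    have hint : interior (Iic (0 : ℝ)) ⊆ Iic 0 := interior_subset
    refine monotoneOn_of_deriv_nonneg (convex_Iic 0)
      (fun s hs => (hG s hs).continuousAt.continuousWithinAt)
      (fun s hs => (hG s (hint hs)).differentiableAt.differentiableWithinAt) ?_
    intro s hs
    rw [(hG s (hint hs)).deriv]
    exact hG' s (hint hs)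
  have hlim : ∀ (G : ℝ → ℝ) (c : ℝ), MonotoneOn G (Iic 0) → Tendsto G atBot (𝓝 c) →
      ∀ s ≤ 0, c ≤ G s := by
    intro G c hG hc s hs
    refine le_of_tendsto hc ?_
    filter_upwards [eventually_le_atBot s] with t ht
    exact hG (ht.trans hs) hs ht
  -- The derivative of the circle integral increases with `s` and tends to `2π F1(0) = 0` at `-∞`,
  -- so it is nonnegative.
  have hA1nn := hlim _ _ (hmono _ _
    (fun s hs => hA2 s (fun θ => exp_add_mul_I_smul_mem hD hs θ)) hA2nn)
    (tendsto_circle_integral_atBot hDo hD cF1)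
  have hfin := hlim _ _ (hmono _ _
    (fun s hs => hA1 s (fun θ => exp_add_mul_I_smul_mem hD hs θ))
    (fun s hs => by simpa [hF1] using hA1nn s hs))
    (tendsto_circle_integral_atBot hDo hD hφ.continuousOn) 0 le_rfl
  simpa using hfin

end SmoothSubmean

/-! ### Extended-real integrals and the normalized circle measure -/

section ExtendedIntegral

variable {α : Type*} [MeasurableSpace α] {μ : Measure α}

lemma eintegral_mono {f g : α → EReal} (h : ∀ a, f a ≤ g a) : eintegral μ f ≤ eintegral μ g := by
  refine EReal.sub_le_sub ?_ ?_
  · exact EReal.coe_ennreal_le_coe_ennreal_iff.2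
      (lintegral_mono fun a => EReal.toENNReal_le_toENNReal (h a))
  · exact EReal.coe_ennreal_le_coe_ennreal_iff.2
      (lintegral_mono fun a => EReal.toENNReal_le_toENNReal (EReal.neg_le_neg_iff.2 (h a)))

lemma eintegral_coe {f : α → ℝ} (hf : Integrable f μ) :
    eintegral μ (fun a => (f a : EReal)) = ((∫ a, f a ∂μ : ℝ) : EReal) := by
  have h1 : ∫⁻ a, ENNReal.ofReal (f a) ∂μ ≠ ⊤ := hf.lintegral_lt_top.ne
  have h2 : ∫⁻ a, ENNReal.ofReal (-f a) ∂μ ≠ ⊤ := hf.neg.lintegral_lt_top.ne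
  rw [integral_eq_lintegral_pos_part_sub_lintegral_neg_part hf, eintegral]
  simp only [← EReal.coe_neg, EReal.toENNReal_of_ne_top (EReal.coe_ne_top _), EReal.toReal_coe]
  rw [EReal.coe_sub, EReal.coe_ennreal_toReal h1, EReal.coe_ennreal_toReal h2]

end ExtendedIntegral

/-- The normalized Lebesgue measure on `[0, 2π]`. -/
noncomputable abbrev circleMeasure : Measure ℝ :=
  ENNReal.ofReal (2 * Real.pi)⁻¹ • (volume : Measure ℝ).restrict (Icc 0 (2 * Real.pi))

instance : IsProbabilityMeasure circleMeasure := ⟨by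
  have h : (0 : ℝ) < 2 * Real.pi := by positivity
  simp only [Measure.smul_apply, Measure.restrict_apply MeasurableSet.univ, univ_inter,
    Real.volume_Icc, sub_zero, smul_eq_mul]
  rw [← ENNReal.ofReal_mul (inv_nonneg.2 h.le), inv_mul_cancel₀ h.ne', ENNReal.ofReal_one]⟩

lemma integral_circleMeasure (f : ℝ → ℝ) :
    ∫ θ, f θ ∂circleMeasure = (2 * Real.pi)⁻¹ * ∫ θ in (0 : ℝ)..2 * Real.pi, f θ := by
  have h : (0 : ℝ) < 2 * Real.pi := by positivity
  rw [integral_smul_measure, ENNReal.toReal_ofReal (inv_nonneg.2 h.le), smul_eq_mul,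
    intervalIntegral.integral_of_le h.le, integral_Icc_eq_integral_Ioc]

/-! ### Bounded ω-psh functions: constants, convex combinations, truncation -/

section BoundedPsh

variable {n : ℕ} {X : Type*} [TopologicalSpace X] [ChartedSpace (Cn n) X] {K : KahlerForm n X}

/-- A real-valued bounded `ω`-psh function. -/
structure IsBddOmegaPsh (K : KahlerForm n X) (u : X → ℝ) : Prop where
  bdd : ∃ C, ∀ x, |u x| ≤ C
  usc : UpperSemicontinuous u
  submean : ∀ e ∈ atlas (Cn n) X, ∀ (D : Set (Cn n)) (φ : Cn n → ℝ), IsLocalPotential K e D φ →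
    ∀ a b : Cn n, (∀ ζ : ℂ, ‖ζ‖ ≤ 1 → a + ζ • b ∈ D) →
      φ a + u (e.symm a) ≤ ∫ θ : ℝ, (φ (a + Complex.exp (θ * Complex.I) • b) +
        u (e.symm (a + Complex.exp (θ * Complex.I) • b))) ∂circleMeasure

lemma circle_mem {n : ℕ} {D : Set (Cn n)} {a b : Cn n} (h : ∀ ζ : ℂ, ‖ζ‖ ≤ 1 → a + ζ • b ∈ D)
    (θ : ℝ) : a + Complex.exp (θ * Complex.I) • b ∈ D :=
  h _ (Complex.norm_exp_ofReal_mul_I θ).le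

lemma integrable_of_measurable_of_abs_le {α : Type*} [MeasurableSpace α] {μ : Measure α}
    [IsFiniteMeasure μ] {f : α → ℝ} (hf : Measurable f) {C : ℝ} (hC : ∀ x, |f x| ≤ C) :
    Integrable f μ :=
  Integrable.of_bound hf.aestronglyMeasurable C (Eventually.of_forall hC)

namespace IsLocalPotential

variable {e : OpenPartialHomeomorph X (Cn n)} {D : Set (Cn n)} {φ : Cn n → ℝ}
  (hφ : IsLocalPotential K e D φ) {a b : Cn n} (hab : ∀ ζ : ℂ, ‖ζ‖ ≤ 1 → a + ζ • b ∈ D)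
include hφ hab

lemma continuous_circle :
    Continuous fun θ : ℝ => φ (a + Complex.exp (θ * Complex.I) • b) :=
  hφ.smooth.continuousOn.comp_continuous (by fun_prop) (circle_mem hab)

lemma continuous_symm_circle :
    Continuous fun θ : ℝ => e.symm (a + Complex.exp (θ * Complex.I) • b) :=
  e.continuousOn_symm.comp_continuous (by fun_prop) (fun θ => hφ.subset (circle_mem hab θ))

lemma integrable_circle :
    Integrable (fun θ : ℝ => φ (a + Complex.exp (θ * Complex.I) • b)) circleMeasure := by
  obtain ⟨C, hC⟩ := (isCompact_closedBall (0 : ℂ) 1).exists_bound_of_continuousOn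
    (f := fun ζ : ℂ => φ (a + ζ • b))
    (hφ.smooth.continuousOn.comp (by fun_prop) (fun ζ hζ => hab ζ (by simpa using hζ)))
  exact integrable_of_measurable_of_abs_le (hφ.continuous_circle hab).measurable
    (fun θ => hC _ (by simp [Complex.norm_exp_ofReal_mul_I]))

lemma measurable_circle {u : X → ℝ} (hu : UpperSemicontinuous u) :
    Measurable fun θ : ℝ => u (e.symm (a + Complex.exp (θ * Complex.I) • b)) :=
  (hu.comp (hφ.continuous_symm_circle hab)).measurable

lemma integrable_comp_circle {u : X → ℝ} (hu : UpperSemicontinuous u) {C : ℝ}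
    (hC : ∀ x, |u x| ≤ C) :
    Integrable (fun θ : ℝ => u (e.symm (a + Complex.exp (θ * Complex.I) • b))) circleMeasure :=
  integrable_of_measurable_of_abs_le (hφ.measurable_circle hab hu) (fun _ => hC _)

lemma integrable_add_comp_circle {u : X → ℝ} (hu : UpperSemicontinuous u) {C : ℝ}
    (hC : ∀ x, |u x| ≤ C) :
    Integrable (fun θ : ℝ => φ (a + Complex.exp (θ * Complex.I) • b) +
      u (e.symm (a + Complex.exp (θ * Complex.I) • b))) circleMeasure :=
  (hφ.integrable_circle hab).add (hφ.integrable_comp_circle hab hu hC)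

/-- `dd^c φ (w, iw)` is the Laplacian of `φ` along the complex line of `w`, so positivity of the
Kähler form makes its potentials subharmonic on lines. This is what makes constants ω-psh. -/
lemma le_circle_integral (he : e ∈ atlas (Cn n) X) :
    φ a ≤ ∫ θ : ℝ, φ (a + Complex.exp (θ * Complex.I) • b) ∂circleMeasure := by
  have hcont : Continuous fun w : Cn n => a + w := by fun_prop
  have h := two_pi_mul_le_circle_integral_of_laplacian_nonneg (hφ.isOpen.preimage hcont)
    (φ := fun w => φ (a + w)) (b := b)
    (hφ.smooth.comp (contDiff_const.add contDiff_id).contDiffOn (fun w hw => hw)) hab (by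
      intro z hz w
      have hderiv : fderiv ℝ (fun w => φ (a + w)) = fun w => fderiv ℝ φ (a + w) := by
        ext1 w; exact fderiv_comp_add_left a
      rw [hderiv, fderiv_comp_add_left a]
      rcases eq_or_ne w 0 with rfl | hw
      · simp
      have h1 := K.pos e he (a + z) (hφ.subset hz) w hw
      rw [← hφ.ddc_eq (a + z) hz, ddc, smul_smul, Complex.I_mul_I, neg_one_smul, map_neg] at h1
      linarith)
  have hpi : (0 : ℝ) < 2 * Real.pi := by positivity
  rw [integral_circleMeasure, inv_mul_eq_div, le_div_iff₀ hpi, mul_comm]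
  simpa using h

end IsLocalPotential

namespace IsBddOmegaPsh

lemma const (c : ℝ) : IsBddOmegaPsh K (fun _ : X => c) where
  bdd := ⟨|c|, fun _ => le_rfl⟩
  usc := upperSemicontinuous_const
  submean e he D φ hφ a b hab := by
    rw [integral_add (hφ.integrable_circle hab) (integrable_const c)]
    simpa using hφ.le_circle_integral hab he

lemma isOmegaPsh {u : X → ℝ} (hu : IsBddOmegaPsh K u) : IsOmegaPsh K (fun x => (u x : EReal)) where
  lt_top x := EReal.coe_lt_top _
  usc := continuous_coe_real_ereal.comp_upperSemicontinuous hu.usc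
    EReal.coe_strictMono.monotone
  nontrivial x := ⟨x, mem_connectedComponent, EReal.coe_ne_bot _⟩
  psh e he D φ hφ := by
    refine ⟨fun z _ => ?_, ?_, fun a b hab => ?_⟩
    · rw [← EReal.coe_add]; exact EReal.coe_lt_top _
    · simp only [← EReal.coe_add]
      refine continuous_coe_real_ereal.comp_upperSemicontinuousOn ?_ EReal.coe_strictMono.monotone
      refine hφ.smooth.continuousOn.upperSemicontinuousOn.add ?_
      exact (hu.usc.upperSemicontinuousOn univ).comp
        (e.continuousOn_symm.mono hφ.subset) (mapsTo_univ _ _)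
    · obtain ⟨C, hC⟩ := hu.bdd
      simp only [circleMean, ← EReal.coe_add]
      rw [eintegral_coe (hφ.integrable_add_comp_circle hab hu.usc hC)]
      exact EReal.coe_le_coe_iff.2 (hu.submean e he D φ hφ a b hab)

lemma convexCombination {u v : X → ℝ} (hu : IsBddOmegaPsh K u) (hv : IsBddOmegaPsh K v) {s t : ℝ}
    (hs : 0 ≤ s) (ht : 0 ≤ t) (hst : s + t = 1) : IsBddOmegaPsh K (fun x => s * u x + t * v x) := by
  obtain ⟨C, hC⟩ := hu.bdd
  obtain ⟨C', hC'⟩ := hv.bdd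
  refine ⟨⟨s * C + t * C', fun x => ?_⟩, ?_, fun e he D φ hφ a b hab => ?_⟩
  · calc |s * u x + t * v x| ≤ |s * u x| + |t * v x| := abs_add_le _ _
      _ = s * |u x| + t * |v x| := by rw [abs_mul, abs_mul, abs_of_nonneg hs, abs_of_nonneg ht]
      _ ≤ s * C + t * C' := by gcongr <;> simp [hC, hC']
  · exact ((continuous_const_mul s).comp_upperSemicontinuous hu.usc
      (monotone_mul_left_of_nonneg hs)).add ((continuous_const_mul t).comp_upperSemicontinuous
      hv.usc (monotone_mul_left_of_nonneg ht))
  · have iu := hφ.integrable_add_comp_circle hab hu.usc hC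
    have iv := hφ.integrable_add_comp_circle hab hv.usc hC'
    have h1 := hu.submean e he D φ hφ a b hab
    have h2 := hv.submean e he D φ hφ a b hab
    have h3 : ∫ θ : ℝ, (φ (a + Complex.exp (θ * Complex.I) • b) +
        (s * u (e.symm (a + Complex.exp (θ * Complex.I) • b)) +
          t * v (e.symm (a + Complex.exp (θ * Complex.I) • b)))) ∂circleMeasure =
        s * ∫ θ : ℝ, (φ (a + Complex.exp (θ * Complex.I) • b) +
          u (e.symm (a + Complex.exp (θ * Complex.I) • b))) ∂circleMeasure +
        t * ∫ θ : ℝ, (φ (a + Complex.exp (θ * Complex.I) • b) +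
          v (e.symm (a + Complex.exp (θ * Complex.I) • b))) ∂circleMeasure := by
      rw [← integral_const_mul, ← integral_const_mul,
        ← integral_add (iu.const_mul s) (iv.const_mul t)]
      congr 1 with θ
      obtain rfl : t = 1 - s := by linarith
      ring
    rw [h3]
    have h4 : φ a = s * φ a + t * φ a := by rw [← add_mul, hst, one_mul]
    have := mul_le_mul_of_nonneg_left h1 hs
    have := mul_le_mul_of_nonneg_left h2 ht
    linarith

end IsBddOmegaPsh

/-- At the centre of a disc the maximum is either `m` or `v`; the sub-mean inequality of that one
suffices, since both lie below the maximum on the circle. The upper bound comes from semicontinuity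
on a compact space. -/
lemma IsOmegaPsh.exists_isBddOmegaPsh_eq_max [CompactSpace X] {v : X → EReal}
    (hv : IsOmegaPsh K v) (m : ℝ) :
    ∃ u : X → ℝ, IsBddOmegaPsh K u ∧ ∀ x, (u x : EReal) = max (v x) m := by
  have hfin : ∀ x, ((max (v x) m).toReal : EReal) = max (v x) m := fun x =>
    EReal.coe_toReal (max_lt (hv.lt_top x) (EReal.coe_lt_top m)).ne
      (lt_of_lt_of_le (EReal.bot_lt_coe m) (le_max_right _ _)).ne'
  have husc : UpperSemicontinuous fun x => (max (v x) m).toReal := by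
    intro x c hc
    have : max (v x) m < (c : EReal) := by rw [← hfin]; exact EReal.coe_lt_coe_iff.2 hc
    filter_upwards [hv.usc x c (lt_of_le_of_lt (le_max_left _ _) this)] with y hy
    rw [← EReal.coe_lt_coe_iff, hfin]
    exact max_lt hy (lt_of_le_of_lt (le_max_right _ _) this)
  have hlow : ∀ x, m ≤ (max (v x) m).toReal := fun x => by
    rw [← EReal.coe_le_coe_iff, hfin]; exact le_max_right _ _
  have hbdd : ∃ C, ∀ x, |(max (v x) m).toReal| ≤ C := by
    obtain ⟨C, hC⟩ := (husc.upperSemicontinuousOn univ).bddAbove_of_isCompact isCompact_univ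
    refine ⟨max C (-m), fun x => abs_le.2 ⟨?_, ?_⟩⟩
    · have := le_max_right C (-m)
      linarith [hlow x]
    · exact (hC (mem_image_of_mem _ (mem_univ x))).trans (le_max_left _ _)
  refine ⟨fun x => (max (v x) m).toReal, ⟨hbdd, husc, fun e he D φ hφ a b hab => ?_⟩, hfin⟩
  obtain ⟨C, hC⟩ := hbdd
  have hint := hφ.integrable_add_comp_circle hab husc hC
  rcases le_total (v (e.symm a)) m with h | h
  · have h1 := (IsBddOmegaPsh.const (K := K) m).submean e he D φ hφ a b hab
    rw [max_eq_right h, EReal.toReal_coe]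
    refine h1.trans (integral_mono ((hφ.integrable_circle hab).add (integrable_const m)) hint ?_)
    intro θ
    exact add_le_add_right (hlow _) _
  · have h1 := (hv.psh e he D φ hφ).submean a b hab
    rw [← EReal.coe_le_coe_iff, EReal.coe_add, hfin, max_eq_left h]
    refine h1.trans ?_
    rw [← eintegral_coe hint]
    refine eintegral_mono fun θ => ?_
    rw [EReal.coe_add]
    exact add_le_add_right ((le_max_left _ _).trans (hfin _).ge) _

end BoundedPsh

/-! ### Continuous approximation of semicontinuous functions -/

section Approximation

variable {X : Type*} [TopologicalSpace X] [CompactSpace X]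

lemma LowerSemicontinuous.exists_real_le {h : X → EReal} (hlsc : LowerSemicontinuous h)
    (hbot : ∀ x, h x ≠ ⊥) : ∃ m : ℝ, ∀ x, (m : EReal) ≤ h x := by
  rcases isEmpty_or_nonempty X with hX | hX
  · exact ⟨0, fun x => hX.elim x⟩
  obtain ⟨x₀, -, hx₀⟩ := (hlsc.lowerSemicontinuousOn univ).exists_isMinOn univ_nonempty
    isCompact_univ
  obtain ⟨m, hm⟩ := EReal.lt_iff_exists_real_btwn.1 (bot_lt_iff_ne_bot.2 (hbot x₀))
  exact ⟨m, fun x => hm.2.le.trans (hx₀ (mem_univ x))⟩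

/-- A lower semicontinuous function on a compact metrizable space is the limit of an increasing
sequence of continuous functions. -/
lemma LowerSemicontinuous.exists_monotone_continuousMap [TopologicalSpace.MetrizableSpace X] {h : X → EReal}
    (hlsc : LowerSemicontinuous h) (hbot : ∀ x, h x ≠ ⊥) :
    ∃ g : ℕ → C(X, ℝ), Monotone g ∧ (∀ k x, (g k x : EReal) ≤ h x) ∧
      ∀ x, Tendsto (fun k => (g k x : EReal)) atTop (𝓝 (h x)) := by
  let := TopologicalSpace.metrizableSpaceMetric X
  rcases isEmpty_or_nonempty X with hX | hX
  · exact ⟨fun _ => 0, monotone_const, fun k x => hX.elim x, fun x => hX.elim x⟩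
  obtain ⟨m₀, hm₀⟩ := hlsc.exists_real_le hbot
  -- Taking `m ≤ 0` keeps `m` below every truncation level `k : ℕ`.
  set m : ℝ := min m₀ 0 with hm
  have hmh : ∀ x, (m : EReal) ≤ h x := fun x =>
    (EReal.coe_le_coe_iff.2 (min_le_left _ _)).trans (hm₀ x)
  -- The approximants are the inf-convolutions `⨅ y, (H k y + k * dist x y)`: `k`-Lipschitz, and
  -- increasing in `k` because both the truncation and the slope are.
  set H : ℕ → X → ℝ := fun k y => (min (h y) (k : ℝ)).toReal with hH
  have hcoe : ∀ k y, (H k y : EReal) = min (h y) (k : ℝ) := fun k y =>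
    EReal.coe_toReal (lt_of_le_of_lt (min_le_right _ _) (EReal.coe_lt_top _)).ne
      (lt_min (bot_lt_iff_ne_bot.2 (hbot y)) (EReal.bot_lt_coe _)).ne'
  have hmH : ∀ k y, m ≤ H k y := fun k y => by
    rw [← EReal.coe_le_coe_iff, hcoe]
    refine le_min (hmh y) (EReal.coe_le_coe_iff.2 ?_)
    exact (min_le_right _ _).trans (Nat.cast_nonneg k)
  have hHmono : ∀ {k l : ℕ}, k ≤ l → ∀ y, H k y ≤ H l y := fun {k l} hkl y => by
    rw [← EReal.coe_le_coe_iff, hcoe, hcoe]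
    exact min_le_min_left _ (EReal.coe_le_coe_iff.2 (by exact_mod_cast hkl))
  have hbdd : ∀ (k : ℕ) (x : X), BddBelow (range fun y => H k y + k * dist x y) := by
    refine fun k x => ⟨m, ?_⟩
    rintro _ ⟨y, rfl⟩
    have : 0 ≤ (k : ℝ) * dist x y := by positivity
    linarith [hmH k y]
  have hlip : ∀ k : ℕ, LipschitzWith k fun x => ⨅ y, (H k y + k * dist x y) := by
    refine fun k => LipschitzWith.of_le_add_mul k fun x x' => ?_
    rw [← sub_le_iff_le_add]
    refine le_ciInf fun y => ?_
    rw [sub_le_iff_le_add]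
    refine (ciInf_le (hbdd k x) y).trans ?_
    have h1 : (k : ℝ) * dist x y ≤ k * (dist x x' + dist x' y) := by
      gcongr; exact dist_triangle _ _ _
    simp only [NNReal.coe_natCast]
    linarith
  have hle : ∀ k x, ((⨅ y, (H k y + k * dist x y) : ℝ) : EReal) ≤ h x := fun k x => by
    refine le_trans ?_ (min_le_left (h x) ((k : ℝ) : EReal))
    rw [← hcoe, EReal.coe_le_coe_iff]
    simpa using ciInf_le (hbdd k x) x
  refine ⟨fun k => ⟨_, (hlip k).continuous⟩, ?_, hle, ?_⟩
  · intro k l hkl x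
    refine ciInf_mono (hbdd k x) fun y => add_le_add (hHmono hkl y) ?_
    gcongr
  · intro x
    refine tendsto_order.2 ⟨fun c hc => ?_, fun c hc => ?_⟩
    · obtain ⟨c', hcc', hc'⟩ := EReal.lt_iff_exists_real_btwn.1 hc
      obtain ⟨r, hr, hball⟩ := Metric.eventually_nhds_iff.1 (hlsc x c' hc')
      -- The first bound puts the truncation above `c'` for `y` near `x`; the second makes the
      -- penalty `k * r` compensate for `H k y` being as low as `m` when `y` is far.
      obtain ⟨k₀, hk₀⟩ := exists_nat_ge (max c' ((c' - m) / r))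
      filter_upwards [eventually_ge_atTop k₀] with k hk
      refine lt_of_lt_of_le hcc' (EReal.coe_le_coe_iff.2 (le_ciInf fun y => ?_))
      have hkk : (k₀ : ℝ) ≤ k := by exact_mod_cast hk
      rcases lt_or_ge (dist y x) r with hy | hy
      · have h1 : c' ≤ H k y := by
          rw [← EReal.coe_le_coe_iff, hcoe]
          exact le_min (hball hy).le
            (EReal.coe_le_coe_iff.2 ((le_max_left _ _).trans (hk₀.trans hkk)))
        have : 0 ≤ (k : ℝ) * dist x y := by positivity
        linarith
      · have h1 : (c' - m) / r ≤ k := (le_max_right _ _).trans (hk₀.trans hkk)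
        rw [div_le_iff₀ hr] at h1
        have h2 : (k : ℝ) * r ≤ k * dist x y := by
          rw [dist_comm]; gcongr
        linarith [hmH k y]
    · exact Eventually.of_forall fun k => lt_of_le_of_lt (hle k x) hc

end Approximation

/-! ### Limits of extended integrals and Riesz representation -/

section MonotoneConvergence

variable {α : Type*} [MeasurableSpace α] {μ : Measure α}

/-- Monotone convergence for the extended integral. -/
lemma tendsto_eintegral_of_monotone {f : ℕ → α → ℝ} {F : α → EReal}
    (hf : ∀ k, Integrable (f k) μ) (hm : ∀ k, Measurable (f k)) (hmono : Monotone f)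
    (hF : ∀ x, Tendsto (fun k => (f k x : EReal)) atTop (𝓝 (F x))) :
    Tendsto (fun k => ((∫ x, f k x ∂μ : ℝ) : EReal)) atTop (𝓝 (eintegral μ F)) := by
  simp only [← eintegral_coe (hf _), eintegral]
  have hneg : ∀ k, ∫⁻ a, (-(f k a : EReal)).toENNReal ∂μ ≠ ⊤ := fun k => by
    have : ∫⁻ a, ENNReal.ofReal (-f k a) ∂μ ≠ ⊤ := (hf k).neg.lintegral_lt_top.ne
    simpa only [← EReal.coe_neg, EReal.toENNReal_of_ne_top (EReal.coe_ne_top _),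
      EReal.toReal_coe] using this
  have hle : ∀ a k, (f k a : EReal) ≤ F a := fun a k =>
    Monotone.ge_of_tendsto (fun i j hij => EReal.coe_le_coe_iff.2 (hmono hij a)) (hF a) k
  have hnegF : ∫⁻ a, (-F a).toENNReal ∂μ ≠ ⊤ := by
    refine ne_top_of_le_ne_top (hneg 0) (lintegral_mono fun a => ?_)
    exact EReal.toENNReal_le_toENNReal (EReal.neg_le_neg_iff.2 (hle a 0))
  have hpos : Tendsto (fun k => ∫⁻ a, (f k a : EReal).toENNReal ∂μ) atTop
      (𝓝 (∫⁻ a, (F a).toENNReal ∂μ)) := by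
    refine lintegral_tendsto_of_tendsto_of_monotone
      (fun k => (hm k).coe_real_ereal.ereal_toENNReal.aemeasurable) ?_ ?_
    · exact Eventually.of_forall fun a i j hij =>
        EReal.toENNReal_le_toENNReal (EReal.coe_le_coe_iff.2 (hmono hij a))
    · exact Eventually.of_forall fun a =>
        (EReal.continuous_toENNReal.tendsto (F a)).comp (hF a)
  have hnegt : Tendsto (fun k => ∫⁻ a, (-(f k a : EReal)).toENNReal ∂μ) atTop
      (𝓝 (∫⁻ a, (-F a).toENNReal ∂μ)) := by
    refine lintegral_tendsto_of_tendsto_of_antitone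
      (fun k => (hm k).coe_real_ereal.neg.ereal_toENNReal.aemeasurable) ?_ (hneg 0) ?_
    · exact Eventually.of_forall fun a i j hij =>
        EReal.toENNReal_le_toENNReal (EReal.neg_le_neg_iff.2 (EReal.coe_le_coe_iff.2 (hmono hij a)))
    · exact Eventually.of_forall fun a =>
        (EReal.continuous_toENNReal.tendsto (-F a)).comp
          ((continuous_neg.tendsto (F a)).comp (hF a))
  have h1 := (continuous_coe_ennreal_ereal.tendsto _).comp hpos
  have h2 := (continuous_coe_ennreal_ereal.tendsto _).comp hnegt
  simp only [sub_eq_add_neg]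
  -- The negative parts have finite integral, so the limit avoids `⊤ - ⊤`, where subtraction is
  -- discontinuous.
  refine (EReal.continuousAt_add (Or.inr ?_) (Or.inl ?_)).tendsto.comp
    (h1.prodMk_nhds ((continuous_neg.tendsto _).comp h2))
  · simpa using hnegF
  · exact EReal.coe_ennreal_ne_bot _

/-- Finiteness excludes `⊤ - ⊤`, which is `⊥` in `EReal` and therefore not compatible with negation.
-/
lemma eintegral_neg {f : α → EReal} (h : ∫⁻ a, (-f a).toENNReal ∂μ ≠ ⊤) :
    eintegral μ (fun a => -f a) = -eintegral μ f := by
  simp only [eintegral, neg_neg]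
  rw [EReal.neg_sub (Or.inl (EReal.coe_ennreal_ne_bot _)) (Or.inr (by simpa using h)), add_comm,
    sub_eq_add_neg]

end MonotoneConvergence

lemma tendsto_add_coe_ereal {ι : Type*} {l : Filter ι} {f : ι → EReal} {c : EReal}
    (hf : Tendsto f l (𝓝 c)) (b : ℝ) : Tendsto (fun i => f i + (b : EReal)) l (𝓝 (c + b)) :=
  (EReal.continuousAt_add (p := (c, (b : EReal))) (Or.inr (EReal.coe_ne_bot b))
    (Or.inr (EReal.coe_ne_top b))).tendsto.comp (hf.prodMk_nhds tendsto_const_nhds)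

/-- A positive linear functional on `C(X, ℝ)`, `X` compact, is the integral with respect to a finite
measure. -/
lemma exists_measure_of_positive_linearMap {X : Type*} [TopologicalSpace X] [T2Space X]
    [CompactSpace X] [MeasurableSpace X] [BorelSpace X] (Λ : C(X, ℝ) →ₗ[ℝ] ℝ)
    (hΛ : ∀ g : C(X, ℝ), 0 ≤ g → 0 ≤ Λ g) :
    ∃ μ : Measure X, IsFiniteMeasure μ ∧ ∀ g : C(X, ℝ), ∫ x, g x ∂μ = Λ g := by
  let Λ' : CompactlySupportedContinuousMap X ℝ →ₚ[ℝ] ℝ := PositiveLinearMap.mk₀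
    { toFun := fun g => Λ g
      map_add' := fun g g' => map_add Λ (g : C(X, ℝ)) g'
      map_smul' := fun c g => map_smul Λ c (g : C(X, ℝ)) }
    (fun g hg => hΛ g hg)
  refine ⟨RealRMK.rieszMeasure Λ', inferInstance, fun g => ?_⟩
  exact RealRMK.integral_rieszMeasure Λ'
    (CompactlySupportedContinuousMap.continuousMapEquiv g)

/-! ### Hahn–Banach duality between envelopes and Jensen pairs -/

section Duality

variable {n : ℕ} {X : Type*} [TopologicalSpace X] [ChartedSpace (Cn n) X] {K : KahlerForm n X}

lemma IsBddOmegaPsh.add_const {u : X → ℝ} (hu : IsBddOmegaPsh K u) (c : ℝ) :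
    IsBddOmegaPsh K (fun x => u x + c) := by
  obtain ⟨C, hC⟩ := hu.bdd
  refine ⟨⟨C + |c|, fun x => (abs_add_le _ _).trans (add_le_add_left (hC x) _)⟩,
    hu.usc.add upperSemicontinuous_const, fun e he D φ hφ a b hab => ?_⟩
  have h := hu.submean e he D φ hφ a b hab
  simp only [← add_assoc]
  rw [integral_add (hφ.integrable_add_comp_circle hab hu.usc hC) (integrable_const c)]
  simpa using h

variable (K) in
/-- The open hypograph of the envelope at `x`, as a function of the continuous obstacle. -/
def envelopeHypograph (x : X) : Set (C(X, ℝ) × ℝ) :=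
  {p | ∃ v : X → ℝ, IsBddOmegaPsh K v ∧ (∀ y, v y ≤ p.1 y) ∧ p.2 < v x}

lemma convex_envelopeHypograph (x : X) : Convex ℝ (envelopeHypograph K x) := by
  rintro ⟨g, t⟩ ⟨v, hv, hvg, htv⟩ ⟨g', t'⟩ ⟨v', hv', hvg', htv'⟩ α β hα hβ hαβ
  refine ⟨_, hv.convexCombination hv' hα hβ hαβ, fun y => ?_, ?_⟩
  · have := mul_le_mul_of_nonneg_left (hvg y) hα
    have := mul_le_mul_of_nonneg_left (hvg' y) hβ
    simp only [Prod.smul_mk, Prod.mk_add_mk, ContinuousMap.add_apply, ContinuousMap.smul_apply,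
      smul_eq_mul]
    linarith
  · simp only [Prod.smul_mk, Prod.mk_add_mk, smul_eq_mul] at htv htv' ⊢
    rcases hα.eq_or_lt with rfl | hα'
    · obtain rfl : β = 1 := by linarith
      linarith
    · have := mul_lt_mul_of_pos_left htv hα'
      have := mul_le_mul_of_nonneg_left htv'.le hβ
      linarith

/-- Lowering the competitor by half of the gap `v x - t` leaves room to move both the obstacle, in
sup norm, and the height. -/
lemma isOpen_envelopeHypograph [CompactSpace X] (x : X) : IsOpen (envelopeHypograph K x) := by
  rw [Metric.isOpen_iff]
  rintro ⟨g, t⟩ ⟨v, hv, hvg, htv⟩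
  simp only at hvg htv
  refine ⟨(v x - t) / 2, by linarith, ?_⟩
  rintro ⟨g', t'⟩ hgt
  rw [Metric.mem_ball, Prod.dist_eq, max_lt_iff] at hgt
  refine ⟨_, hv.add_const (-((v x - t) / 2)), fun y => ?_, ?_⟩
  · have h1 := (ContinuousMap.dist_apply_le_dist y).trans hgt.1.le
    rw [Real.dist_eq] at h1
    have := (abs_le.1 h1).1
    have := hvg y
    simp only at *
    linarith
  · have h2 := hgt.2
    rw [Real.dist_eq] at h2
    have := (abs_lt.1 h2).2
    simp only at *
    linarith

/-- Hahn–Banach: an affine majorant of the envelope at `x` on continuous obstacles, bounded by the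
envelope of `h` on the continuous obstacles below `h`. -/
lemma exists_affine_majorant [CompactSpace X] {h : X → EReal} {m s : ℝ} {x : X}
    (hm : ∀ y, (m : EReal) ≤ h y) (hs : omegaPshEnvelope K h x = s) :
    ∃ (Λ : C(X, ℝ) →ₗ[ℝ] ℝ) (b : ℝ), (∀ g : C(X, ℝ), 0 ≤ g → 0 ≤ Λ g) ∧
      (∀ (v : X → ℝ) (g : C(X, ℝ)), IsBddOmegaPsh K v → (∀ y, v y ≤ g y) → v x ≤ Λ g + b) ∧
      ∀ g : C(X, ℝ), (∀ y, (g y : EReal) ≤ h y) → Λ g + b ≤ s := by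
  have hB : Convex ℝ {p : C(X, ℝ) × ℝ | (∀ y, (p.1 y : EReal) ≤ h y) ∧ p.2 = s} := by
    rintro ⟨g, t⟩ ⟨hg, ht⟩ ⟨g', t'⟩ ⟨hg', ht'⟩ α β hα hβ hαβ
    simp only at hg ht hg' ht'
    subst ht ht'
    refine ⟨fun y => ?_, by simp [← add_mul, hαβ]⟩
    simp only [Prod.smul_mk, Prod.mk_add_mk, ContinuousMap.add_apply, ContinuousMap.smul_apply,
      smul_eq_mul]
    -- Passing through the maximum of `g y` and `g' y` avoids convexity arithmetic in `EReal`.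
    refine le_trans (EReal.coe_le_coe_iff.2 (?_ : _ ≤ max (g y) (g' y))) ?_
    · have := mul_le_mul_of_nonneg_left (le_max_left (g y) (g' y)) hα
      have := mul_le_mul_of_nonneg_left (le_max_right (g y) (g' y)) hβ
      have : α * max (g y) (g' y) + β * max (g y) (g' y) = max (g y) (g' y) := by
        rw [← add_mul, hαβ, one_mul]
      linarith
    · rcases max_choice (g y) (g' y) with h' | h' <;> rw [h']
      exacts [hg y, hg' y]
  obtain ⟨f, u, hfA, hfB⟩ := geometric_hahn_banach_open (convex_envelopeHypograph (K := K) x)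
    (isOpen_envelopeHypograph x) hB (by
      rw [Set.disjoint_left]
      rintro ⟨g, t⟩ ⟨v, hv, hvg, htv⟩ ⟨hg, ht⟩
      simp only at hvg htv hg ht
      subst ht
      have : (v x : EReal) ≤ omegaPshEnvelope K h x :=
        le_sSup ⟨_, hv.isOmegaPsh, fun y => (EReal.coe_le_coe_iff.2 (hvg y)).trans (hg y), rfl⟩
      rw [hs, EReal.coe_le_coe_iff] at this
      linarith)
  set c : ℝ := f (0, 1) with hc
  have hf : ∀ (g : C(X, ℝ)) (t : ℝ), f (g, t) = f (g, 0) + c * t := fun g t => by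
    have : (g, t) = (g, (0 : ℝ)) + t • ((0 : C(X, ℝ)), (1 : ℝ)) := by simp
    rw [this, map_add, map_smul, smul_eq_mul, mul_comm]
  -- The separating hyperplane is not vertical: over the constant obstacle `m`, the hypograph has a
  -- point strictly below height `s`.
  have hcpos : 0 < c := by
    have h1 := hfA (ContinuousMap.const X m, min m s - 1) ⟨_, IsBddOmegaPsh.const m,
      fun y => le_rfl, by
        have := min_le_left m s
        simp only
        linarith⟩
    have h2 := hfB (ContinuousMap.const X m, s) ⟨hm, rfl⟩
    rw [hf] at h1 h2
    have h3 : c * (min m s - 1) < c * s := by linarith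
    by_contra hneg
    have := min_le_right m s
    nlinarith
  have hmaj : ∀ (v : X → ℝ) (g : C(X, ℝ)), IsBddOmegaPsh K v → (∀ y, v y ≤ g y) →
      v x ≤ -(f (g, 0) / c) + u / c := by
    intro v g hv hvg
    refine le_of_forall_lt fun t ht => ?_
    have h1 := hfA (g, t) ⟨v, hv, hvg, ht⟩
    rw [hf] at h1
    have : t < (u - f (g, 0)) / c := by
      rw [lt_div_iff₀ hcpos]; linarith
    rwa [sub_div, sub_eq_neg_add] at this
  refine ⟨⟨⟨fun g => -(f (g, 0) / c), fun g g' => ?_⟩, fun r g => ?_⟩, u / c, fun g hg => ?_, hmaj,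
    fun g hg => ?_⟩
  · have : (g + g', (0 : ℝ)) = (g, 0) + (g', 0) := by simp
    rw [this, map_add]
    ring
  · have : (r • g, (0 : ℝ)) = r • (g, 0) := by simp
    simp only [this, map_smul, smul_eq_mul, RingHom.id_apply]
    ring
  -- The competitor `0` under the obstacles `k • g` gives `0 ≤ k Λ(g) + b` for all `k`, which forces
  -- `Λ(g) ≥ 0`.
  · have hk : ∀ k : ℕ, 0 ≤ k * -(f (g, 0) / c) + u / c := fun k => by
      have h1 := hmaj (fun _ => 0) ((k : ℝ) • g) (IsBddOmegaPsh.const 0)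
        (fun y => mul_nonneg (Nat.cast_nonneg k) (hg y))
      have : ((k : ℝ) • g, (0 : ℝ)) = (k : ℝ) • (g, 0) := by simp
      rw [this, map_smul, smul_eq_mul] at h1
      refine h1.trans_eq ?_
      ring
    change 0 ≤ -(f (g, 0) / c)
    by_contra hneg
    rw [not_le] at hneg
    obtain ⟨k, hk'⟩ := exists_nat_gt ((u / c) / -(-(f (g, 0) / c)))
    rw [div_lt_iff₀ (by linarith)] at hk'
    linarith [hk k]
  · have h2 := hfB (g, s) ⟨hg, rfl⟩
    rw [hf] at h2
    change -(f (g, 0) / c) + u / c ≤ s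
    rw [← sub_eq_neg_add, ← sub_div, div_le_iff₀ hcpos]
    linarith

variable [MeasurableSpace X]

lemma omegaPshEnvelope_le_jensenEnvelope (h : X → EReal) (x : X) :
    omegaPshEnvelope K h x ≤ jensenEnvelope K h x := by
  refine sSup_le ?_
  rintro _ ⟨v, hv, hvh, rfl⟩
  refine le_sInf ?_
  rintro _ ⟨μ, b, hμ, rfl⟩
  exact (hμ.le v hv).trans (add_le_add_left (eintegral_mono hvh) _)

variable [CompactSpace X] [BorelSpace X]

/-- An ω-psh `u` is a decreasing limit of continuous functions `-g k`. The hypothesis applies to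
truncations of `u` below each of them, and monotone convergence passes to the limit. -/
lemma isJensenPair_of_forall_isBddOmegaPsh [TopologicalSpace.MetrizableSpace X] {x : X}
    {μ : Measure X} [IsFiniteMeasure μ] {b : ℝ}
    (hmaj : ∀ (v : X → ℝ) (g : C(X, ℝ)), IsBddOmegaPsh K v → (∀ y, v y ≤ g y) →
      v x ≤ ∫ y, g y ∂μ + b) : IsJensenPair K x μ b := by
  refine ⟨inferInstance, fun u hu => ?_⟩
  have hlsc : LowerSemicontinuous fun y => -u y :=
    continuous_neg.comp_upperSemicontinuous_antitone hu.usc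
      (fun a b hab => EReal.neg_le_neg_iff.2 hab)
  have hbot : ∀ y, -u y ≠ ⊥ := fun y => by simpa using (hu.lt_top y).ne
  obtain ⟨g, hg, hgu, hgt⟩ := hlsc.exists_monotone_continuousMap hbot
  have hint : ∀ k, Integrable (g k) μ := fun k =>
    integrable_of_measurable_of_abs_le (g k).continuous.measurable
      (fun y => (g k).norm_coe_le_norm y)
  have hlim := tendsto_eintegral_of_monotone (μ := μ) hint (fun k => (g k).continuous.measurable)
    (fun i j hij y => hg hij y) hgt
  have hfin : ∫⁻ y, (- -u y).toENNReal ∂μ ≠ ⊤ := by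
    obtain ⟨C, hC⟩ := hlsc.exists_real_le hbot
    refine ne_top_of_le_ne_top (b := ∫⁻ _, ENNReal.ofReal (-C) ∂μ) ?_ (lintegral_mono fun y => ?_)
    · simpa using ENNReal.mul_ne_top ENNReal.ofReal_ne_top (measure_ne_top μ univ)
    · refine (EReal.toENNReal_le_toENNReal (EReal.neg_le_neg_iff.2 (hC y))).trans_eq ?_
      rw [← EReal.coe_neg, EReal.toENNReal_of_ne_top (EReal.coe_ne_top _), EReal.toReal_coe]
  have hneg := eintegral_neg hfin
  simp only [neg_neg] at hneg
  rw [hneg]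
  refine ge_of_tendsto' (tendsto_add_coe_ereal ((continuous_neg.tendsto _).comp hlim) b)
    fun k => ?_
  -- At level `-‖g k‖` the truncation still lies below `-g k`.
  obtain ⟨v, hv, hvu⟩ := hu.exists_isBddOmegaPsh_eq_max (-‖g k‖)
  have h1 := hmaj v (-g k) hv fun y => by
    rw [← EReal.coe_le_coe_iff, hvu]
    refine max_le ?_ (EReal.coe_le_coe_iff.2 ?_)
    · have := EReal.neg_le_neg_iff.2 (hgu k y)
      rw [neg_neg] at this
      simpa using this
    · simpa using (le_abs_self _).trans ((g k).norm_coe_le_norm y)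
  refine (le_max_left (u x) ((-‖g k‖ : ℝ) : EReal)).trans ?_
  rw [← hvu]
  refine (EReal.coe_le_coe_iff.2 h1).trans_eq ?_
  simp only [ContinuousMap.neg_apply, integral_neg, EReal.coe_add, EReal.coe_neg,
    Function.comp_apply]

lemma jensenEnvelope_le_omegaPshEnvelope [T2Space X] [TopologicalSpace.MetrizableSpace X] {h : X → EReal}
    (hbot : ∀ x, h x ≠ ⊥) (hlsc : LowerSemicontinuous h) (x : X) :
    jensenEnvelope K h x ≤ omegaPshEnvelope K h x := by
  obtain ⟨m, hm⟩ := hlsc.exists_real_le hbot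
  have hge : (m : EReal) ≤ omegaPshEnvelope K h x :=
    le_sSup ⟨_, (IsBddOmegaPsh.const m).isOmegaPsh, hm, rfl⟩
  rcases eq_or_ne (omegaPshEnvelope K h x) ⊤ with htop | htop
  · rw [htop]; exact le_top
  have hs := (EReal.coe_toReal htop (ne_bot_of_le_ne_bot (EReal.coe_ne_bot m) hge)).symm
  obtain ⟨Λ, b, hpos, hmaj, hle⟩ := exists_affine_majorant hm hs
  obtain ⟨μ, hμ, hint⟩ := exists_measure_of_positive_linearMap Λ hpos
  have hJ : IsJensenPair K x μ b :=
    isJensenPair_of_forall_isBddOmegaPsh fun v g hv hvg => by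
      rw [hint]; exact hmaj v g hv hvg
  have hE : jensenEnvelope K h x ≤ eintegral μ h + b := sInf_le ⟨μ, b, hJ, rfl⟩
  refine hE.trans ?_
  obtain ⟨g, hg, hgh, hgt⟩ := hlsc.exists_monotone_continuousMap hbot
  have hlim := tendsto_eintegral_of_monotone (μ := μ)
    (fun k => integrable_of_measurable_of_abs_le (g k).continuous.measurable
      (fun y => (g k).norm_coe_le_norm y))
    (fun k => (g k).continuous.measurable) (fun i j hij y => hg hij y) hgt
  refine le_of_tendsto' (tendsto_add_coe_ereal hlim b) fun k => ?_
  rw [hs, hint, ← EReal.coe_add, EReal.coe_le_coe_iff]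
  exact hle (g k) (hgh k)

end Duality

/-! ### Upper semicontinuous regularization of the envelope -/

section Regularization

lemma upperSemicontinuous_uscReg {X : Type*} [TopologicalSpace X] (f : X → EReal) :
    UpperSemicontinuous (uscReg f) := by
  intro x c hc
  obtain ⟨c', h1, h2⟩ := exists_between hc
  filter_upwards [eventually_eventually_nhds.2 (eventually_lt_of_limsup_lt h1)] with y hy
  exact lt_of_le_of_lt (limsup_le_of_le (h := hy.mono fun _ h => h.le)) h2

lemma le_uscReg {X : Type*} [TopologicalSpace X] (f : X → EReal) (x : X) : f x ≤ uscReg f x :=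
  le_limsup_of_frequently_le (frequently_iff.2 fun hU => ⟨x, mem_of_mem_nhds hU, le_rfl⟩)

/-- Fatou's lemma for circle means of a bounded upper semicontinuous function. -/
lemma eventually_integral_circle_lt {n : ℕ} {D : Set (Cn n)} {g : Cn n → ℝ} {a b : Cn n} {B c : ℝ}
    (hD : ∀ᶠ z in 𝓝 a, ∀ ζ : ℂ, ‖ζ‖ ≤ 1 → z + ζ • b ∈ D)
    (hg : ∀ z ∈ D, UpperSemicontinuousAt g z)
    (hB : ∀ᶠ z in 𝓝 a, ∀ ζ : ℂ, ‖ζ‖ ≤ 1 → |g (z + ζ • b)| ≤ B)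
    (hc : ∫ θ : ℝ, g (a + Complex.exp (θ * Complex.I) • b) ∂circleMeasure < c) :
    ∀ᶠ z in 𝓝 a, ∫ θ : ℝ, g (z + Complex.exp (θ * Complex.I) • b) ∂circleMeasure < c := by
  -- Otherwise some `z k → a` have circle means at least `c`; Fatou applied to the nonnegative
  -- functions `B - g` contradicts `hc`.
  by_contra hcon
  obtain ⟨z, hz, hzc⟩ := exists_seq_forall_of_frequently
    ((not_eventually.1 hcon).and_eventually (hD.and hB))
  have hmeas : ∀ w : Cn n, (∀ ζ : ℂ, ‖ζ‖ ≤ 1 → w + ζ • b ∈ D) →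
      Measurable fun θ : ℝ => g (w + Complex.exp (θ * Complex.I) • b) := fun w hw =>
    UpperSemicontinuous.measurable fun θ => (hg _ (circle_mem hw θ)).comp
      (g := fun θ : ℝ => w + Complex.exp (θ * Complex.I) • b)
      (Continuous.continuousAt (by fun_prop))
  have hbd : ∀ w : Cn n, (∀ ζ : ℂ, ‖ζ‖ ≤ 1 → |g (w + ζ • b)| ≤ B) → ∀ θ : ℝ,
      |g (w + Complex.exp (θ * Complex.I) • b)| ≤ B := fun w hw θ =>
    hw _ (Complex.norm_exp_ofReal_mul_I θ).le
  have hlint : ∀ w : Cn n, (∀ ζ : ℂ, ‖ζ‖ ≤ 1 → w + ζ • b ∈ D) →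
      (∀ ζ : ℂ, ‖ζ‖ ≤ 1 → |g (w + ζ • b)| ≤ B) →
      ∫⁻ θ : ℝ, ENNReal.ofReal (B - g (w + Complex.exp (θ * Complex.I) • b)) ∂circleMeasure =
        ENNReal.ofReal (B - ∫ θ : ℝ, g (w + Complex.exp (θ * Complex.I) • b) ∂circleMeasure) := by
    intro w hw hwB
    have hint : Integrable (fun θ : ℝ => g (w + Complex.exp (θ * Complex.I) • b))
      circleMeasure := integrable_of_measurable_of_abs_le (hmeas w hw) (hbd w hwB)
    have h1 := ofReal_integral_eq_lintegral_ofReal ((integrable_const B).sub hint)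
      (Eventually.of_forall fun θ => sub_nonneg.2 (abs_le.1 (hbd w hwB θ)).2)
    refine h1.symm.trans ?_
    rw [integral_sub' (integrable_const B) hint]
    simp
  have hDa := hD.self_of_nhds
  have hcB : c ≤ B := by
    obtain ⟨h1, h2, h3⟩ := hzc 0
    refine (not_lt.1 h1).trans ?_
    have hint := integrable_of_measurable_of_abs_le (μ := circleMeasure) (hmeas _ h2) (hbd _ h3)
    refine (integral_mono hint (integrable_const B)
      (fun θ => (abs_le.1 (hbd _ h3 θ)).2)).trans_eq ?_
    simp
  have hfatou : ENNReal.ofReal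
      (B - ∫ θ : ℝ, g (a + Complex.exp (θ * Complex.I) • b) ∂circleMeasure) ≤
      ENNReal.ofReal (B - c) := by
    rw [← hlint a hDa hB.self_of_nhds]
    calc ∫⁻ θ : ℝ, ENNReal.ofReal (B - g (a + Complex.exp (θ * Complex.I) • b)) ∂circleMeasure
        ≤ ∫⁻ θ : ℝ, liminf (fun k => ENNReal.ofReal
            (B - g (z k + Complex.exp (θ * Complex.I) • b))) atTop ∂circleMeasure := by
          refine lintegral_mono fun θ => le_of_forall_lt fun t ht => ?_
          obtain ⟨t', htt', ht'⟩ := exists_between ht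
          have hlsc : LowerSemicontinuousAt (fun w => ENNReal.ofReal (B - g w))
              (a + Complex.exp (θ * Complex.I) • b) :=
            (ENNReal.continuous_ofReal.comp (continuous_const.sub
              continuous_id)).continuousAt.comp_upperSemicontinuousAt_antitone (hg _ (circle_mem hDa θ))
              (fun x y hxy => ENNReal.ofReal_le_ofReal (sub_le_sub_left hxy B))
          have hev := (hz.add_const (Complex.exp (θ * Complex.I) • b)).eventually (hlsc t' ht')
          exact lt_of_lt_of_le htt' (le_liminf_of_le (h := hev.mono fun _ h => h.le))
      _ ≤ liminf (fun k => ∫⁻ θ : ℝ, ENNReal.ofReal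
            (B - g (z k + Complex.exp (θ * Complex.I) • b)) ∂circleMeasure) atTop :=
          lintegral_liminf_le fun k =>
            (measurable_const.sub (hmeas _ (hzc k).2.1)).ennreal_ofReal
      _ ≤ ENNReal.ofReal (B - c) := by
          refine liminf_le_of_frequently_le (Frequently.of_forall fun k => ?_)
          rw [hlint _ (hzc k).2.1 (hzc k).2.2]
          exact ENNReal.ofReal_le_ofReal (sub_le_sub_left (not_lt.1 (hzc k).1) _)
  rw [ENNReal.ofReal_le_ofReal_iff (sub_nonneg.2 hcB)] at hfatou
  linarith

variable {n : ℕ} {X : Type*} [TopologicalSpace X] [ChartedSpace (Cn n) X] {K : KahlerForm n X}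

/-- The upper semicontinuous regularization of a bounded supremum of `ω`-psh functions is
`ω`-psh. -/
lemma isBddOmegaPsh_of_eq_uscReg {f : X → EReal} {u : X → ℝ}
    (hu : ∀ x, (u x : EReal) = uscReg f x) {C : ℝ} (hC : ∀ x, |u x| ≤ C)
    (hf : ∀ (x : X) (c : ℝ), (c : EReal) < f x →
      ∃ v : X → ℝ, IsBddOmegaPsh K v ∧ (∀ y, (v y : EReal) ≤ f y) ∧ c < v x) :
    IsBddOmegaPsh K u := by
  have husc : UpperSemicontinuous u := by
    intro x c hc
    rw [← EReal.coe_lt_coe_iff, hu] at hc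
    filter_upwards [upperSemicontinuous_uscReg f x c hc] with y hy
    rwa [← EReal.coe_lt_coe_iff, hu]
  refine ⟨⟨C, hC⟩, husc, fun e he D φ hφ a b hab => ?_⟩
  -- A closed thickening of the disc inside `D` contains all nearby translates of the disc, and `φ`
  -- is bounded on it.
  have hS : IsCompact ((fun ζ : ℂ => a + ζ • b) '' Metric.closedBall 0 1) :=
    (isCompact_closedBall 0 1).image (by fun_prop)
  obtain ⟨δ, hδ, hSD⟩ := hS.exists_cthickening_subset_open hφ.isOpen (by
    rintro _ ⟨ζ, hζ, rfl⟩
    exact hab ζ (by simpa using hζ))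
  obtain ⟨C', hC'⟩ := (hS.cthickening (r := δ)).exists_bound_of_continuousOn
    (hφ.smooth.continuousOn.mono hSD)
  have hnear : ∀ᶠ z in 𝓝 a, ∀ ζ : ℂ, ‖ζ‖ ≤ 1 →
      z + ζ • b ∈ Metric.cthickening δ ((fun ζ : ℂ => a + ζ • b) '' Metric.closedBall 0 1) := by
    filter_upwards [Metric.closedBall_mem_nhds a hδ] with z hz ζ hζ
    refine Metric.mem_cthickening_of_dist_le _ _ _ _ ⟨ζ, by simpa using hζ, rfl⟩ ?_
    simpa using hz
  have hnearD := hnear.mono fun z hz ζ hζ => hSD (hz ζ hζ)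
  have haD : a ∈ D := by simpa using hab 0 (by simp)
  refine le_of_forall_pos_le_add fun ε hε => ?_
  set I := ∫ θ : ℝ, (φ (a + Complex.exp (θ * Complex.I) • b) +
        u (e.symm (a + Complex.exp (θ * Complex.I) • b))) ∂circleMeasure with hI
  have hmean := eventually_integral_circle_lt (g := fun z => φ z + u (e.symm z)) (B := C' + C)
    (c := I + ε / 2) hnearD (fun w hw =>
      ((hφ.smooth.continuousOn.continuousAt (hφ.isOpen.mem_nhds hw)).upperSemicontinuousAt).add
      ((husc _).comp (e.continuousAt_symm (hφ.subset hw))))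
    (hnear.mono fun z hz ζ hζ =>
      (abs_add_le _ _).trans (add_le_add (hC' _ (hz ζ hζ)) (hC _))) (by
      rw [← hI]; linarith)
  have hφa : ∀ᶠ z in 𝓝 a, φ a - ε / 2 < φ z :=
    (hφ.smooth.continuousOn.continuousAt (hφ.isOpen.mem_nhds haD)).eventually
      (lt_mem_nhds (by linarith))
  have hfz : ∀ᶠ z in 𝓝 a, f (e.symm z) ≤ ((I + ε - φ a : ℝ) : EReal) := by
    filter_upwards [hmean, hnearD, hφa] with z h1 h2 h3
    by_contra hlt
    -- A minorant `v` nearly attaining `f` at `z` obeys the sub-mean inequality on the disc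
    -- translated to `z`. Since `v ≤ u`, its mean is at most that of `u`, which `hmean` bounds; no
    -- measurability of `f` is needed.
    obtain ⟨v, hv, hvf, hcv⟩ := hf _ _ (not_le.1 hlt)
    obtain ⟨Cv, hCv⟩ := hv.bdd
    have h4 := hv.submean e he D φ hφ z b h2
    have h5 := integral_mono (hφ.integrable_add_comp_circle h2 hv.usc hCv)
      (hφ.integrable_add_comp_circle h2 husc hC) (fun θ => add_le_add_right (by
        rw [← EReal.coe_le_coe_iff, hu]
        exact (hvf _).trans (le_uscReg f _)) _)
    linarith
  have hlim : uscReg f (e.symm a) ≤ ((I + ε - φ a : ℝ) : EReal) := by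
    refine limsup_le_of_le (h := ?_)
    rw [← e.symm.map_nhds_eq (by simpa using hφ.subset haD), eventually_map]
    exact hfz
  rw [← hu, EReal.coe_le_coe_iff] at hlim
  linarith

/-- Continuity of `h` gives `P* ≤ limsup h = h`, so `P*`, being ω-psh, is itself a competitor for
`P`. -/
lemma uscReg_omegaPshEnvelope [CompactSpace X] {h : X → EReal} (hbot : ∀ x, h x ≠ ⊥)
    (htop : ∀ x, h x ≠ ⊤) (hcont : Continuous h) :
    uscReg (omegaPshEnvelope K h) = omegaPshEnvelope K h := by
  obtain ⟨m, hm⟩ := hcont.lowerSemicontinuous.exists_real_le hbot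
  obtain ⟨M, hM⟩ := LowerSemicontinuous.exists_real_le (h := fun x => -h x)
    hcont.neg.lowerSemicontinuous (fun x => by simpa using htop x)
  have hPh : ∀ x, omegaPshEnvelope K h x ≤ h x := fun x => by
    refine sSup_le ?_
    rintro _ ⟨v, -, hvh, rfl⟩
    exact hvh x
  have hRh : ∀ x, uscReg (omegaPshEnvelope K h) x ≤ h x := fun x =>
    (limsup_le_limsup (Eventually.of_forall hPh)).trans_eq (hcont.tendsto x).limsup_eq
  have hle : ∀ {v : X → ℝ}, IsBddOmegaPsh K v → (∀ y, (v y : EReal) ≤ h y) →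
      ∀ x, (v x : EReal) ≤ omegaPshEnvelope K h x := fun hv hvh x =>
    le_sSup ⟨_, hv.isOmegaPsh, hvh, rfl⟩
  have hmR : ∀ x, (m : EReal) ≤ uscReg (omegaPshEnvelope K h) x := fun x =>
    (hle (IsBddOmegaPsh.const m) hm x).trans (le_uscReg _ x)
  have hcoe : ∀ x, ((uscReg (omegaPshEnvelope K h) x).toReal : EReal) =
      uscReg (omegaPshEnvelope K h) x := fun x =>
    EReal.coe_toReal (ne_top_of_le_ne_top (htop x) (hRh x))
      (ne_bot_of_le_ne_bot (EReal.coe_ne_bot m) (hmR x))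
  have hpsh : IsBddOmegaPsh K fun x => (uscReg (omegaPshEnvelope K h) x).toReal := by
    refine isBddOmegaPsh_of_eq_uscReg (C := max (-M) (-m)) hcoe (fun x => abs_le.2 ⟨?_, ?_⟩) ?_
    · refine (neg_le.1 (le_max_right (-M) (-m))).trans ?_
      rw [← EReal.coe_le_coe_iff, hcoe]
      exact hmR x
    · refine le_trans ?_ (le_max_left (-M) (-m))
      rw [← EReal.coe_le_coe_iff, hcoe, EReal.coe_neg]
      exact (hRh x).trans (EReal.le_neg.1 (hM x))
    · intro x c hc
      obtain ⟨_, ⟨v, hv, hvh, rfl⟩, hcv⟩ := lt_sSup_iff.1 hc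
      -- Truncating at a lower bound `m` of `h` keeps the competitor below `h`.
      obtain ⟨w, hw, hwv⟩ := hv.exists_isBddOmegaPsh_eq_max m
      refine ⟨w, hw, hle hw fun y => ?_, ?_⟩
      · rw [hwv]; exact max_le (hvh y) (hm y)
      · rw [← EReal.coe_lt_coe_iff, hwv]
        exact lt_of_lt_of_le hcv (le_max_left _ _)
  funext x
  refine le_antisymm ?_ (le_uscReg _ x)
  rw [← hcoe]
  exact hle hpsh (fun y => by rw [hcoe]; exact hRh y) x

end Regularization

theorem mainTheorem7 {n : ℕ} {X : Type*} [TopologicalSpace X] [T2Space X] [CompactSpace X]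
    [ChartedSpace (Cn n) X] [IsManifold 𝓘(ℂ, Cn n) ω X] [MeasurableSpace X] [BorelSpace X]
    (K : KahlerForm n X) (h : X → EReal) (hbot : ∀ x, h x ≠ ⊥) (hlsc : LowerSemicontinuous h) :
    omegaPshEnvelope K h = jensenEnvelope K h ∧
      (Continuous h → (∀ x, h x ≠ ⊤) → uscReg (omegaPshEnvelope K h) = jensenEnvelope K h) := by
  -- Together with compactness and the Hausdorff property, this makes `X` metrizable.
  have : SecondCountableTopology X := ChartedSpace.secondCountable_of_sigmaCompact (Cn n) X
  have heq : omegaPshEnvelope K h = jensenEnvelope K h := funext fun x =>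
    le_antisymm (omegaPshEnvelope_le_jensenEnvelope h x)
      (jensenEnvelope_le_omegaPshEnvelope hbot hlsc x)
  exact ⟨heq, fun hcont htop => (uscReg_omegaPshEnvelope hbot htop hcont).trans heq⟩
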